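/- Let $k\in\mathbb{N}=\{1,2,\dots\}$. There are constants $0<c_k\le C_k<\infty$, depending only on $k$, such that the following holds. Let $N\ge 1$ and let $X$ be a rearrangement-invariant Banach function space on $\mathbb{R}^N$ (in the sense of Bennett--Sharpley, with Lebesgue measure) with absolutely continuous norm, that is, $\|f\mathbf 1_{E_n}\|_X\to0$ for every $f\in X$ and every sequence of measurable sets $E_n$ with $\mathbf 1_{E_n}\to0$ a.e. For a scalar-valued function $f$ on $\mathbb{R}^N$ and $h\in\mathbb{R}^N$ put $$\Delta_h^kf(x)=\sum_{j=0}^k(-1)^{j+k}\binom kj f(x+jh).$$ Then, for every $f\in X$, the function $h\mapsto\|\Delta_h^kf\|_X$ is measurable, the limit $\lim_{|h|\to\infty}\|\Delta_h^kf\|_X$ exists and is finite, and $$c_k\|f\|_X\le\lim_{|h|\to\infty}\|\Delta_h^kf\|_X\le C_k\|f\|_X .$$ Moreover, let $p\in(0,\infty)$ and let $\{\psi_\varepsilon\}_{\varepsilon>0}$ be a family of non-negative functions on $(0,\infty)$ with $$\int_0^\infty\psi_\varepsilon(t)\,dt=1\quad(\varepsilon>0),\qquad \lim_{\varepsilon\to0^+}\int_a^\infty\psi_\varepsilon(t)\,dt=1\quad\text{for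 every }a>1,$$ and put $\varphi_\varepsilon(t)=\int_{t^k}^\infty u^{-N/k}\psi_\varepsilon(u)\,du$ for $t>0$. Then, for every $f\in X$, $$\lim_{\varepsilon\to0^+}\int_{\mathbb{R}^N}\|\Delta_h^kf\|_X^p\,\varphi_\varepsilon(|h|)\,dh=\frac{|\mathbb{S}^{N-1}|}{N}\,\lim_{|h|\to\infty}\|\Delta_h^kf\|_X^p ,$$ where $|\mathbb{S}^{N-1}|$ is the surface measure of the unit sphere of $\mathbb{R}^N$ (so $|\mathbb{S}^0|=2$). -/

import Mathlib

open MeasureTheory Filter Topology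
open scoped ENNReal NNReal

/-- A rearrangement-invariant Banach function norm on `ℝ^N` with Lebesgue measure. `rho` is
defined on non-negative extended-valued functions; only its values on (Lebesgue) measurable
functions matter. -/
structure RISpace (N : ℕ) where
  /-- the function norm -/
  rho : (EuclideanSpace ℝ (Fin N) → ℝ≥0∞) → ℝ≥0∞
  rho_eq_zero_iff : ∀ f : EuclideanSpace ℝ (Fin N) → ℝ≥0∞, AEMeasurable f volume →
    (rho f = 0 ↔ f =ᵐ[volume] 0)
  rho_const_mul : ∀ (a : ℝ≥0) (f : EuclideanSpace ℝ (Fin N) → ℝ≥0∞), AEMeasurable f volume →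
    rho (fun x => (a : ℝ≥0∞) * f x) = (a : ℝ≥0∞) * rho f
  rho_add_le : ∀ f g : EuclideanSpace ℝ (Fin N) → ℝ≥0∞, AEMeasurable f volume →
    AEMeasurable g volume → rho (fun x => f x + g x) ≤ rho f + rho g
  /-- lattice property -/
  rho_mono : ∀ f g : EuclideanSpace ℝ (Fin N) → ℝ≥0∞, AEMeasurable f volume →
    AEMeasurable g volume → (∀ᵐ x ∂volume, f x ≤ g x) → rho f ≤ rho g
  /-- Fatou property -/
  rho_iSup : ∀ f : ℕ → EuclideanSpace ℝ (Fin N) → ℝ≥0∞, (∀ n, AEMeasurable (f n) volume) →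
    (∀ᵐ x ∂volume, Monotone fun n => f n x) → rho (fun x => ⨆ n, f n x) = ⨆ n, rho (f n)
  rho_indicator_lt_top : ∀ E : Set (EuclideanSpace ℝ (Fin N)), MeasurableSet E →
    volume E < ∞ → rho (E.indicator fun _ => 1) < ∞
  setLIntegral_le : ∀ E : Set (EuclideanSpace ℝ (Fin N)), MeasurableSet E →
    volume E < ∞ → ∃ C : ℝ≥0, ∀ f : EuclideanSpace ℝ (Fin N) → ℝ≥0∞, AEMeasurable f volume →
      ∫⁻ x in E, f x ≤ (C : ℝ≥0∞) * rho f
  /-- rearrangement invariance: equimeasurable a.e. finite functions have the same norm -/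
  rho_equimeasurable : ∀ f g : EuclideanSpace ℝ (Fin N) → ℝ≥0∞, AEMeasurable f volume →
    AEMeasurable g volume → (∀ᵐ x ∂volume, f x < ∞) → (∀ᵐ x ∂volume, g x < ∞) →
    (∀ s : ℝ≥0, volume {x | (s : ℝ≥0∞) < f x} = volume {x | (s : ℝ≥0∞) < g x}) → rho f = rho g

namespace RISpace

/-- `‖f‖_X`, as an extended non-negative number. -/
noncomputable def enorm {N : ℕ} (X : RISpace N) {𝕜 : Type*} [RCLike 𝕜]
    (f : EuclideanSpace ℝ (Fin N) → 𝕜) : ℝ≥0∞ :=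
  X.rho fun x => ‖f x‖ₑ

/-- `f ∈ X`. -/
def Mem {N : ℕ} (X : RISpace N) {𝕜 : Type*} [RCLike 𝕜]
    (f : EuclideanSpace ℝ (Fin N) → 𝕜) : Prop :=
  AEStronglyMeasurable f volume ∧ X.enorm f < ∞

/-- `X` has absolutely continuous norm: `‖f 𝟏_{E n}‖_X → 0` for all `f ∈ X` and all sequences of
measurable sets `E n` whose indicator functions tend to `0` almost everywhere. -/
def HasAbsolutelyContinuousNorm {N : ℕ} (X : RISpace N) : Prop :=
  ∀ f : EuclideanSpace ℝ (Fin N) → ℝ≥0∞, AEMeasurable f volume → X.rho f < ∞ →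
    ∀ E : ℕ → Set (EuclideanSpace ℝ (Fin N)), (∀ n, MeasurableSet (E n)) →
      (∀ᵐ x ∂volume, ∀ᶠ n in atTop, x ∉ E n) →
      Tendsto (fun n => X.rho ((E n).indicator f)) atTop (𝓝 0)

end RISpace

/-- The `k`-th difference `Δ_h^k f (x) = ∑_{j=0}^k (-1)^{j+k} (k choose j) f (x + j h)`. -/
noncomputable def kthDifference {N : ℕ} {𝕜 : Type*} [RCLike 𝕜] (k : ℕ)
    (h : EuclideanSpace ℝ (Fin N)) (f : EuclideanSpace ℝ (Fin N) → 𝕜) :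
    EuclideanSpace ℝ (Fin N) → 𝕜 :=
  fun x => ∑ j ∈ Finset.range (k + 1), (-1) ^ (j + k) * (k.choose j : 𝕜) * f (x + (j : ℝ) • h)

/-- A family `(ψ ε)_{ε > 0}` of non-negative functions on `(0, ∞)` of total mass one that
concentrates at infinity as `ε → 0+`. (Integrability follows from the integral being `1`.) -/
structure IsConcentratingAtInfinity (ψ : ℝ → ℝ → ℝ) : Prop where
  nonneg : ∀ ε > 0, ∀ t > 0, 0 ≤ ψ ε t
  integral_eq_one : ∀ ε > 0, ∫ t in Set.Ioi (0 : ℝ), ψ ε t = 1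
  tendsto_tail : ∀ a > 1, Tendsto (fun ε => ∫ t in Set.Ioi a, ψ ε t) (𝓝[>] 0) (𝓝 1)

/-- The weight `t ↦ ∫_{t^k}^∞ u^{-N/k} ψ(u) du`, `t > 0`. -/
noncomputable def tailWeight (N k : ℕ) (ψ : ℝ → ℝ) (t : ℝ) : ℝ :=
  ∫ u in Set.Ioi (t ^ k), u ^ (-((N : ℝ) / (k : ℝ))) * ψ u

/-!
The limit exists because of rearrangement invariance. If `g` vanishes outside a ball, then for large
`h` the translates `x ↦ g (x + j h)`, `0 ≤ j ≤ k`, have disjoint supports, so that the distribution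
function of `Δ_h^k g` is the sum of those of `(k choose j) g` and does not depend on `h`
(`volume_lt_enorm_kthDifference`). Hence `‖Δ_h^k g‖` is constant for large `h`, and it is at least
`‖g‖`, since the term `j = 0` reproduces `|g|` on the support of `g`. Absolute continuity of the norm
makes such `g` dense in `X`, and `‖Δ_h^k f‖ ≤ 2 ^ k ‖f‖`, so for general `f` the quantity
`‖Δ_h^k f‖` oscillates arbitrarily little for large `h`. It therefore converges, and the
inequalities hold with the constants `1` and `2 ^ k`.

Measurability in `h` holds for continuous `g`, because the Fatou property makes `h ↦ ‖Δ_h^k g‖`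
lower semicontinuous. It passes to uniform limits, and continuous functions are dense in `X`: cut an
`L¹` approximation off, and use the dominated convergence theorem
`RISpace.HasAbsolutelyContinuousNorm.tendsto_rho_zero`, which follows from absolute continuity.

For the averages, Tonelli's theorem and `|{h | ‖h‖ ^ k < u}| = u ^ (N / k) |B(0, 1)|` show that every
weight `φ_ε(‖h‖)` has total mass `|B(0, 1)| = |S^{N-1}| / N`, while its mass on a fixed ball tends
to zero as `ε → 0+`. Averaging a bounded function against such weights produces its limit at infinity
(`tendsto_lintegral_mul_of_tendsto_cobounded`).
-/

/-! ### Rearrangement-invariant norms -/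

namespace RISpace

variable {N : ℕ} {𝕜 : Type*} [RCLike 𝕜]

theorem rho_zero (X : RISpace N) : X.rho (fun _ => 0) = 0 :=
  (X.rho_eq_zero_iff _ aemeasurable_const).2 (ae_of_all _ fun _ => rfl)

theorem rho_sum_le (X : RISpace N) {ι : Type*} (s : Finset ι)
    (u : ι → EuclideanSpace ℝ (Fin N) → ℝ≥0∞) (hu : ∀ i, AEMeasurable (u i) volume) :
    X.rho (fun x => ∑ i ∈ s, u i x) ≤ ∑ i ∈ s, X.rho (u i) := by
  classical
  induction s using Finset.induction_on with
  | empty => simp [rho_zero]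
  | insert a s ha ih =>
    simp only [Finset.sum_insert ha]
    exact (X.rho_add_le _ _ (hu a) (Finset.aemeasurable_fun_sum s fun i _ => hu i)).trans
      (add_le_add_right ih _)

theorem enorm_mono (X : RISpace N) {f g : EuclideanSpace ℝ (Fin N) → 𝕜}
    (hf : AEStronglyMeasurable f volume) (hg : AEStronglyMeasurable g volume)
    (hfg : ∀ x, ‖f x‖ₑ ≤ ‖g x‖ₑ) : X.enorm f ≤ X.enorm g :=
  X.rho_mono _ _ hf.enorm hg.enorm (ae_of_all _ hfg)

theorem enorm_le_add_enorm_sub (X : RISpace N) {f g : EuclideanSpace ℝ (Fin N) → 𝕜}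
    (hf : AEStronglyMeasurable f volume) (hg : AEStronglyMeasurable g volume) :
    X.enorm f ≤ X.enorm g + X.enorm (fun x => f x - g x) := by
  refine le_trans ?_ (X.rho_add_le _ _ hg.enorm (hf.sub hg).enorm)
  refine X.rho_mono _ _ hf.enorm (hg.enorm.add (hf.sub hg).enorm) (ae_of_all _ fun x => ?_)
  calc ‖f x‖ₑ = ‖g x + (f x - g x)‖ₑ := by rw [add_sub_cancel]
    _ ≤ _ := enorm_add_le _ _

theorem rho_congr_ae (X : RISpace N) {u v : EuclideanSpace ℝ (Fin N) → ℝ≥0∞}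
    (hu : AEMeasurable u volume) (h : u =ᵐ[volume] v) : X.rho u = X.rho v :=
  le_antisymm (X.rho_mono _ _ hu (hu.congr h) h.le) (X.rho_mono _ _ (hu.congr h) hu h.symm.le)

theorem enorm_sub_comm (X : RISpace N) (f g : EuclideanSpace ℝ (Fin N) → 𝕜) :
    X.enorm (fun x => f x - g x) = X.enorm (fun x => g x - f x) := by
  simp only [RISpace.enorm, _root_.enorm_sub_rev]

/-- Functions with the same distribution function have the same norm. -/
theorem enorm_eq_of_equimeasurable (X : RISpace N) {f g : EuclideanSpace ℝ (Fin N) → 𝕜}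
    (hf : AEStronglyMeasurable f volume) (hg : AEStronglyMeasurable g volume)
    (h : ∀ s : ℝ≥0, volume {x | (s : ℝ≥0∞) < ‖f x‖ₑ} = volume {x | (s : ℝ≥0∞) < ‖g x‖ₑ}) :
    X.enorm f = X.enorm g :=
  X.rho_equimeasurable _ _ hf.enorm hg.enorm (ae_of_all _ fun _ => enorm_lt_top)
    (ae_of_all _ fun _ => enorm_lt_top) h

theorem _root_.MeasureTheory.AEStronglyMeasurable.comp_add_const
    {f : EuclideanSpace ℝ (Fin N) → 𝕜} (hf : AEStronglyMeasurable f volume)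
    (a : EuclideanSpace ℝ (Fin N)) : AEStronglyMeasurable (fun x => f (x + a)) volume :=
  hf.comp_quasiMeasurePreserving (measurePreserving_add_right volume a).quasiMeasurePreserving

theorem enorm_comp_add_const (X : RISpace N) {f : EuclideanSpace ℝ (Fin N) → 𝕜}
    (hf : AEStronglyMeasurable f volume) (a : EuclideanSpace ℝ (Fin N)) :
    X.enorm (fun x => f (x + a)) = X.enorm f :=
  X.enorm_eq_of_equimeasurable (hf.comp_add_const a) hf fun s =>
    measure_preimage_add_right volume a {x | (s : ℝ≥0∞) < ‖f x‖ₑ}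

/-- Dominated convergence in a space with absolutely continuous norm. -/
theorem HasAbsolutelyContinuousNorm.tendsto_rho_zero {X : RISpace N}
    (hX : X.HasAbsolutelyContinuousNorm) {u : ℕ → EuclideanSpace ℝ (Fin N) → ℝ≥0∞}
    {F : EuclideanSpace ℝ (Fin N) → ℝ≥0∞} (hu : ∀ n, Measurable (u n)) (hF : Measurable F)
    (hFX : X.rho F < ∞) (hle : ∀ n x, u n x ≤ F x)
    (hlim : ∀ᵐ x ∂volume, Tendsto (fun n => u n x) atTop (𝓝 0)) :
    Tendsto (fun n => X.rho (u n)) atTop (𝓝 0) := by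
  -- Given `δ > 0`, split `u n ≤ δ F + 1_{u n > δ F} F`.
  have key : ∀ δ : ℝ≥0, 0 < δ →
      Tendsto (fun n => X.rho ({x | (δ : ℝ≥0∞) * F x < u n x}.indicator F)) atTop (𝓝 0) := by
    intro δ hδ
    refine hX F hF.aemeasurable hFX _
      (fun n => measurableSet_lt (hF.const_mul _) (hu n)) ?_
    filter_upwards [hlim] with x hx
    rcases eq_or_ne (F x) 0 with h0 | h0
    · exact Eventually.of_forall fun n => by
        have := hle n x
        simp_all
    · have hpos : 0 < (δ : ℝ≥0∞) * F x := by
        rw [pos_iff_ne_zero]; exact mul_ne_zero (by simpa using hδ.ne') h0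
      filter_upwards [hx.eventually_lt_const hpos] with n hn
      exact not_lt.2 hn.le
  have hbound : ∀ (δ : ℝ≥0) (n : ℕ), X.rho (u n) ≤
      δ * X.rho F + X.rho ({x | (δ : ℝ≥0∞) * F x < u n x}.indicator F) := by
    intro δ n
    have hS : MeasurableSet {x | (δ : ℝ≥0∞) * F x < u n x} :=
      measurableSet_lt (hF.const_mul _) (hu n)
    rw [← X.rho_const_mul δ F hF.aemeasurable]
    refine le_trans ?_ (X.rho_add_le _ _ (hF.const_mul _).aemeasurable
      (hF.indicator hS).aemeasurable)
    refine X.rho_mono _ _ (hu n).aemeasurable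
      ((hF.const_mul _).add (hF.indicator hS)).aemeasurable (ae_of_all _ fun x => ?_)
    by_cases hx : (δ : ℝ≥0∞) * F x < u n x
    · rw [Set.indicator_of_mem (s := {x | (δ : ℝ≥0∞) * F x < u n x}) hx]
      exact (hle n x).trans le_add_self
    · exact (not_lt.1 hx).trans le_self_add
  rw [ENNReal.tendsto_nhds_zero]
  intro η hη
  have hη2 : 0 < η / 2 := ENNReal.half_pos hη.ne'
  obtain ⟨δ, hδ, hδη⟩ : ∃ δ : ℝ≥0, 0 < δ ∧ (δ : ℝ≥0∞) * X.rho F < η / 2 :=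
    ENNReal.exists_nnreal_pos_mul_lt hFX.ne hη2.ne'
  filter_upwards [(ENNReal.tendsto_nhds_zero.1 (key δ hδ)) _ hη2] with n hn
  exact (hbound δ n).trans ((add_le_add hδη.le hn).trans_eq (ENNReal.add_halves η))

/-- The Fatou property, in the form: a bound on the norms of a sequence passes to the norm of its
pointwise limit. -/
theorem rho_le_of_tendsto (X : RISpace N) {u : ℕ → EuclideanSpace ℝ (Fin N) → ℝ≥0∞}
    {v : EuclideanSpace ℝ (Fin N) → ℝ≥0∞} (hu : ∀ n, Measurable (u n))
    (hlim : ∀ x, Tendsto (fun n => u n x) atTop (𝓝 (v x))) {a : ℝ≥0∞}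
    (ha : ∀ n, X.rho (u n) ≤ a) : X.rho v ≤ a := by
  have hm : ∀ n, Measurable fun x => ⨅ m, u (n + m) x := fun n => Measurable.iInf fun m => hu _
  have hv : v = fun x => ⨆ n, ⨅ m, u (n + m) x := by
    funext x
    rw [← (hlim x).liminf_eq, liminf_eq_iSup_iInf_of_nat']
    simp only [add_comm]
  rw [hv, X.rho_iSup _ (fun n => (hm n).aemeasurable)]
  · refine iSup_le fun n => le_trans ?_ (ha n)
    exact X.rho_mono _ _ (hm n).aemeasurable (hu n).aemeasurable
      (ae_of_all _ fun x => iInf_le_of_le 0 le_rfl)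
  · refine ae_of_all _ fun x => monotone_nat_of_le_succ fun n => le_iInf fun m => ?_
    exact iInf_le_of_le (1 + m) (by rw [← add_assoc])

end RISpace

/-! ### Finite differences -/

section Difference

variable {N : ℕ} {𝕜 : Type*} [RCLike 𝕜] {k : ℕ}

theorem MeasureTheory.AEStronglyMeasurable.kthDifference {f : EuclideanSpace ℝ (Fin N) → 𝕜}
    (hf : AEStronglyMeasurable f volume) (k : ℕ) (h : EuclideanSpace ℝ (Fin N)) :
    AEStronglyMeasurable (kthDifference k h f) volume :=
  Finset.aestronglyMeasurable_fun_sum _ fun j _ =>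
    (hf.comp_add_const ((j : ℝ) • h)).const_mul ((-1) ^ (j + k) * (k.choose j : 𝕜))

theorem kthDifference_sub (k : ℕ) (h : EuclideanSpace ℝ (Fin N))
    (f g : EuclideanSpace ℝ (Fin N) → 𝕜) :
    kthDifference k h (fun x => f x - g x) =
      fun x => kthDifference k h f x - kthDifference k h g x := by
  funext x
  simp only [kthDifference, ← Finset.sum_sub_distrib, mul_sub]

theorem enorm_neg_one_pow_mul_choose (n k j : ℕ) :
    ‖(-1 : 𝕜) ^ n * (k.choose j : 𝕜)‖ₑ = ((k.choose j : ℝ≥0) : ℝ≥0∞) := by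
  rw [enorm_mul, enorm_pow, enorm_neg, enorm_one, one_pow, one_mul, enorm_eq_nnnorm,
    RCLike.nnnorm_natCast]

theorem RISpace.enorm_kthDifference_le (X : RISpace N) {f : EuclideanSpace ℝ (Fin N) → 𝕜}
    (hf : AEStronglyMeasurable f volume) (k : ℕ) (h : EuclideanSpace ℝ (Fin N)) :
    X.enorm (kthDifference k h f) ≤ 2 ^ k * X.enorm f := by
  have hm : ∀ j : ℕ, AEMeasurable (fun x => ‖f (x + (j : ℝ) • h)‖ₑ) volume :=
    fun j => (hf.comp_add_const _).enorm
  calc X.enorm (kthDifference k h f)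
      ≤ X.rho (fun x => ∑ j ∈ Finset.range (k + 1),
          ((k.choose j : ℝ≥0) : ℝ≥0∞) * ‖f (x + (j : ℝ) • h)‖ₑ) := by
        refine X.rho_mono _ _ (hf.kthDifference k h).enorm
          (Finset.aemeasurable_fun_sum _ fun j _ => (hm j).const_mul _) (ae_of_all _ fun x => ?_)
        refine (enorm_sum_le _ _).trans_eq (Finset.sum_congr rfl fun j _ => ?_)
        rw [enorm_mul, enorm_neg_one_pow_mul_choose]
    _ ≤ ∑ j ∈ Finset.range (k + 1), X.rho (fun x =>
          ((k.choose j : ℝ≥0) : ℝ≥0∞) * ‖f (x + (j : ℝ) • h)‖ₑ) :=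
        X.rho_sum_le _ _ fun j => (hm j).const_mul _
    _ = ∑ j ∈ Finset.range (k + 1), ((k.choose j : ℝ≥0) : ℝ≥0∞) * X.enorm f := by
        refine Finset.sum_congr rfl fun j _ => ?_
        rw [X.rho_const_mul _ _ (hm j), ← X.enorm_comp_add_const hf ((j : ℝ) • h)]
        rfl
    _ = 2 ^ k * X.enorm f := by
        rw [← Finset.sum_mul]
        congr 1
        exact_mod_cast Nat.sum_range_choose k

theorem RISpace.enorm_kthDifference_le_add (X : RISpace N) {f g : EuclideanSpace ℝ (Fin N) → 𝕜}
    (hf : AEStronglyMeasurable f volume) (hg : AEStronglyMeasurable g volume) (k : ℕ)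
    (h : EuclideanSpace ℝ (Fin N)) :
    X.enorm (kthDifference k h f) ≤
      X.enorm (kthDifference k h g) + 2 ^ k * X.enorm (fun x => f x - g x) := by
  refine (X.enorm_le_add_enorm_sub (hf.kthDifference k h) (hg.kthDifference k h)).trans ?_
  rw [← kthDifference_sub]
  exact add_le_add_right (X.enorm_kthDifference_le (hf.sub hg) k h) _

/-- If `g` lives on a ball of radius `R` and `2 * R < ‖h‖`, the translates of `g` by distinct
multiples of `h` have disjoint supports. -/
theorem eq_zero_of_ne_of_support_subset {g : EuclideanSpace ℝ (Fin N) → 𝕜} {R : ℝ}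
    (hg : ∀ x, R < ‖x‖ → g x = 0) {h : EuclideanSpace ℝ (Fin N)} (hh : 2 * R < ‖h‖)
    {x : EuclideanSpace ℝ (Fin N)} {i j : ℕ} (hij : i ≠ j) (hi : g (x + (i : ℝ) • h) ≠ 0) :
    g (x + (j : ℝ) • h) = 0 := by
  refine hg _ (lt_of_not_ge fun hj => ?_)
  have hi' : ‖x + (i : ℝ) • h‖ ≤ R := not_lt.1 fun H => hi (hg _ H)
  have h1 : ‖((i : ℝ) - j) • h‖ ≤ 2 * R := by
    have : ((i : ℝ) - j) • h = (x + (i : ℝ) • h) - (x + (j : ℝ) • h) := by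
      rw [sub_smul]; abel
    rw [this]
    linarith [norm_sub_le (x + (i : ℝ) • h) (x + (j : ℝ) • h)]
  have h2 : (1 : ℝ) ≤ |(i : ℝ) - j| := by
    have : (1 : ℤ) ≤ |(i : ℤ) - j| := Int.one_le_abs (sub_ne_zero.2 (by exact_mod_cast hij))
    exact_mod_cast this
  rw [norm_smul, Real.norm_eq_abs] at h1
  nlinarith [norm_nonneg h]

theorem kthDifference_eq_of_ne_zero {g : EuclideanSpace ℝ (Fin N) → 𝕜} {R : ℝ}
    (hg : ∀ x, R < ‖x‖ → g x = 0) {h : EuclideanSpace ℝ (Fin N)} (hh : 2 * R < ‖h‖)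
    {x : EuclideanSpace ℝ (Fin N)} {i : ℕ} (hik : i ∈ Finset.range (k + 1))
    (hi : g (x + (i : ℝ) • h) ≠ 0) :
    kthDifference k h g x = (-1) ^ (i + k) * (k.choose i : 𝕜) * g (x + (i : ℝ) • h) := by
  refine Finset.sum_eq_single_of_mem i hik fun j _ hj => ?_
  rw [eq_zero_of_ne_of_support_subset hg hh hj.symm hi, mul_zero]

/-- For `g` supported in a ball and `h` large, the distribution function of `Δ_h^k g` is the sum
of those of the dilates `(k choose j) g`; it does not depend on `h`. -/
theorem volume_lt_enorm_kthDifference {g : EuclideanSpace ℝ (Fin N) → 𝕜} {R : ℝ}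
    (hgm : AEStronglyMeasurable g volume)
    (hg : ∀ x, R < ‖x‖ → g x = 0) {h : EuclideanSpace ℝ (Fin N)} (hh : 2 * R < ‖h‖) (s : ℝ≥0) :
    volume {x | (s : ℝ≥0∞) < ‖kthDifference k h g x‖ₑ} =
      ∑ j ∈ Finset.range (k + 1),
        volume {x | (s : ℝ≥0∞) < ((k.choose j : ℝ≥0) : ℝ≥0∞) * ‖g x‖ₑ} := by
  have hset : {x | (s : ℝ≥0∞) < ‖kthDifference k h g x‖ₑ} =
      ⋃ j ∈ Finset.range (k + 1),
        {x | (s : ℝ≥0∞) < ((k.choose j : ℝ≥0) : ℝ≥0∞) * ‖g (x + (j : ℝ) • h)‖ₑ} := by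
    ext x
    simp only [Set.mem_ofPred_eq, Set.mem_iUnion, exists_prop]
    constructor
    · intro hx
      obtain ⟨i, hik, hi⟩ : ∃ i ∈ Finset.range (k + 1), g (x + (i : ℝ) • h) ≠ 0 := by
        by_contra! hcon
        have : kthDifference k h g x = 0 :=
          Finset.sum_eq_zero fun j hj => by rw [hcon j hj, mul_zero]
        simp [this] at hx
      refine ⟨i, hik, ?_⟩
      rwa [kthDifference_eq_of_ne_zero hg hh hik hi, enorm_mul,
        enorm_neg_one_pow_mul_choose] at hx
    · rintro ⟨i, hik, hx⟩
      have hi : g (x + (i : ℝ) • h) ≠ 0 := by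
        intro h0
        simp [h0] at hx
      rwa [kthDifference_eq_of_ne_zero hg hh hik hi, enorm_mul, enorm_neg_one_pow_mul_choose]
  rw [hset, measure_biUnion_finset₀]
  · refine Finset.sum_congr rfl fun j _ => ?_
    exact measure_preimage_add_right volume ((j : ℝ) • h)
      {x | (s : ℝ≥0∞) < ((k.choose j : ℝ≥0) : ℝ≥0∞) * ‖g x‖ₑ}
  · intro i _ j _ hij
    refine Disjoint.aedisjoint (Set.disjoint_left.2 fun x hi hj => ?_)
    simp only [Set.mem_ofPred_eq] at hi hj
    have hi0 : g (x + (i : ℝ) • h) ≠ 0 := by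
      intro h0
      simp [h0] at hi
    simp [eq_zero_of_ne_of_support_subset hg hh hij hi0] at hj
  · intro j _
    exact nullMeasurableSet_lt aemeasurable_const
      ((hgm.comp_add_const ((j : ℝ) • h)).enorm.const_mul _)

theorem RISpace.enorm_kthDifference_eq (X : RISpace N) {g : EuclideanSpace ℝ (Fin N) → 𝕜} {R : ℝ}
    (hgm : AEStronglyMeasurable g volume) (hg : ∀ x, R < ‖x‖ → g x = 0)
    {h h' : EuclideanSpace ℝ (Fin N)} (hh : 2 * R < ‖h‖) (hh' : 2 * R < ‖h'‖) :
    X.enorm (kthDifference k h g) = X.enorm (kthDifference k h' g) :=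
  X.enorm_eq_of_equimeasurable (hgm.kthDifference k h) (hgm.kthDifference k h') fun s => by
    rw [volume_lt_enorm_kthDifference hgm hg hh, volume_lt_enorm_kthDifference hgm hg hh']

theorem RISpace.enorm_le_enorm_kthDifference (X : RISpace N)
    {g : EuclideanSpace ℝ (Fin N) → 𝕜} {R : ℝ} (hgm : AEStronglyMeasurable g volume)
    (hg : ∀ x, R < ‖x‖ → g x = 0) {h : EuclideanSpace ℝ (Fin N)} (hh : 2 * R < ‖h‖) :
    X.enorm g ≤ X.enorm (kthDifference k h g) := by
  refine X.enorm_mono hgm (hgm.kthDifference k h) fun x => ?_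
  by_cases hx : g x = 0
  · simp [hx]
  · have hx' : g (x + ((0 : ℕ) : ℝ) • h) ≠ 0 := by simpa using hx
    rw [kthDifference_eq_of_ne_zero hg hh (by simp) hx', enorm_mul,
      enorm_neg_one_pow_mul_choose]
    simp

/-! ### The limit at infinity -/

/-- In a space with absolutely continuous norm, functions vanishing outside a ball are dense. -/
theorem RISpace.Mem.exists_enorm_sub_le {X : RISpace N} (hX : X.HasAbsolutelyContinuousNorm)
    {f : EuclideanSpace ℝ (Fin N) → 𝕜} (hf : X.Mem f) {δ : ℝ≥0∞} (hδ : 0 < δ) :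
    ∃ (g : EuclideanSpace ℝ (Fin N) → 𝕜) (R : ℝ), AEStronglyMeasurable g volume ∧
      (∀ x, R < ‖x‖ → g x = 0) ∧ X.enorm (fun x => f x - g x) ≤ δ := by
  have hlim := hX (fun x => ‖f x‖ₑ) hf.1.enorm hf.2 (fun n : ℕ => (Metric.closedBall 0 n)ᶜ)
    (fun n => Metric.isClosed_closedBall.measurableSet.compl) (ae_of_all _ fun x => by
      filter_upwards [eventually_ge_atTop ⌈‖x‖⌉₊] with n hn
      simpa using (Nat.le_ceil ‖x‖).trans (by exact_mod_cast hn))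
  obtain ⟨n, hn⟩ := (ENNReal.tendsto_nhds_zero.1 hlim δ hδ).exists
  refine ⟨(Metric.closedBall 0 (n : ℝ)).indicator f, n,
    hf.1.indicator Metric.isClosed_closedBall.measurableSet, fun x hx => ?_, ?_⟩
  · exact Set.indicator_of_notMem (by simpa using hx) _
  · refine le_of_eq_of_le (congrArg X.rho (funext fun x => ?_)) hn
    by_cases hx : x ∈ Metric.closedBall (0 : EuclideanSpace ℝ (Fin N)) n
    · simp [hx]
    · simp [hx]

/-- A perturbation of the `h`-independence valid for functions vanishing outside a ball. -/
theorem RISpace.Mem.eventually_enorm_kthDifference_le {X : RISpace N}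
    (hX : X.HasAbsolutelyContinuousNorm) {f : EuclideanSpace ℝ (Fin N) → 𝕜} (hf : X.Mem f)
    (k : ℕ) {δ : ℝ≥0∞} (hδ : 0 < δ) :
    ∃ R : ℝ, (∀ h h' : EuclideanSpace ℝ (Fin N), R < ‖h‖ → R < ‖h'‖ →
      X.enorm (kthDifference k h f) ≤ X.enorm (kthDifference k h' f) + δ) ∧
      ∀ h : EuclideanSpace ℝ (Fin N), R < ‖h‖ →
        X.enorm f ≤ X.enorm (kthDifference k h f) + δ := by
  have hη : 0 < δ / (2 * 2 ^ k) :=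
    ENNReal.div_pos hδ.ne' (ENNReal.mul_ne_top (by simp) (by simp))
  obtain ⟨g, R, hgm, hg, hfg⟩ := hf.exists_enorm_sub_le hX hη
  have hsmall : 2 ^ k * X.enorm (fun x => f x - g x) ≤ δ / 2 := by
    calc (2 : ℝ≥0∞) ^ k * X.enorm (fun x => f x - g x) ≤ 2 ^ k * (δ / (2 * 2 ^ k)) := by gcongr
      _ = δ / 2 := by
        rw [mul_comm (2 : ℝ≥0∞) (2 ^ k), ← mul_div_assoc,
          ENNReal.mul_div_mul_left _ _ (by simp) (by simp)]
  have hsmall' : X.enorm (fun x => f x - g x) ≤ δ / 2 :=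
    le_trans (le_mul_of_one_le_left' (one_le_pow₀ (by norm_num))) hsmall
  have h1 : ∀ h, X.enorm (kthDifference k h f) ≤ X.enorm (kthDifference k h g) + δ / 2 := fun h =>
    (X.enorm_kthDifference_le_add hf.1 hgm k h).trans (add_le_add_right hsmall _)
  have h2 : ∀ h, X.enorm (kthDifference k h g) ≤ X.enorm (kthDifference k h f) + δ / 2 := fun h =>
    (X.enorm_kthDifference_le_add hgm hf.1 k h).trans
      (add_le_add_right ((congrArg _ (X.enorm_sub_comm g f)).trans_le hsmall) _)
  refine ⟨2 * R, fun h h' hh hh' => ?_, fun h hh => ?_⟩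
  · calc _ ≤ _ := h1 h
      _ = X.enorm (kthDifference k h' g) + δ / 2 := by rw [X.enorm_kthDifference_eq hgm hg hh hh']
      _ ≤ X.enorm (kthDifference k h' f) + δ / 2 + δ / 2 := add_le_add_left (h2 h') _
      _ = _ := by rw [add_assoc, ENNReal.add_halves]
  · calc _ ≤ _ := X.enorm_le_add_enorm_sub hf.1 hgm
      _ ≤ X.enorm (kthDifference k h g) + δ / 2 :=
        add_le_add (X.enorm_le_enorm_kthDifference hgm hg hh) hsmall'
      _ ≤ X.enorm (kthDifference k h f) + δ / 2 + δ / 2 := add_le_add_left (h2 h) _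
      _ = _ := by rw [add_assoc, ENNReal.add_halves]

theorem RISpace.Mem.exists_tendsto_enorm_kthDifference {X : RISpace N} (hN : 1 ≤ N)
    (hX : X.HasAbsolutelyContinuousNorm) {f : EuclideanSpace ℝ (Fin N) → 𝕜} (hf : X.Mem f)
    (k : ℕ) :
    ∃ L : ℝ≥0, Tendsto (fun h : EuclideanSpace ℝ (Fin N) => X.enorm (kthDifference k h f))
        (Bornology.cobounded (EuclideanSpace ℝ (Fin N))) (𝓝 (L : ℝ≥0∞)) ∧
      X.enorm f ≤ L ∧ (L : ℝ≥0∞) ≤ 2 ^ k * X.enorm f := by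
  have : Nonempty (Fin N) := ⟨⟨0, hN⟩⟩
  set A := fun h : EuclideanSpace ℝ (Fin N) => X.enorm (kthDifference k h f)
  set l := Bornology.cobounded (EuclideanSpace ℝ (Fin N))
  have hev : ∀ R : ℝ, ∀ᶠ h in l, R < ‖h‖ := fun R =>
    tendsto_norm_cobounded_atTop.eventually_gt_atTop R
  have hlim : Tendsto A l (𝓝 (liminf A l)) := by
    refine tendsto_of_le_liminf_of_limsup_le le_rfl ?_
    refine ENNReal.le_of_forall_pos_le_add fun δ hδ _ => ?_
    obtain ⟨R, hR, -⟩ := hf.eventually_enorm_kthDifference_le hX k (δ := δ) (by simpa using hδ)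
    rw [← tsub_le_iff_right]
    refine le_liminf_of_le (by isBoundedDefault) ?_
    filter_upwards [hev R] with h' hh'
    rw [tsub_le_iff_right]
    refine limsup_le_of_le (by isBoundedDefault) ?_
    filter_upwards [hev R] with h hh
    exact hR h h' hh hh'
  have hub : liminf A l ≤ 2 ^ k * X.enorm f :=
    le_of_tendsto hlim (Eventually.of_forall fun h => X.enorm_kthDifference_le hf.1 k h)
  have htop : liminf A l ≠ ∞ :=
    (hub.trans_lt (ENNReal.mul_lt_top (by simp) hf.2)).ne
  refine ⟨(liminf A l).toNNReal, ?_, ?_, ?_⟩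
  · rwa [ENNReal.coe_toNNReal htop]
  · rw [ENNReal.coe_toNNReal htop]
    refine ENNReal.le_of_forall_pos_le_add fun δ hδ _ => ?_
    obtain ⟨R, -, hR⟩ := hf.eventually_enorm_kthDifference_le hX k (δ := δ) (by simpa using hδ)
    refine ge_of_tendsto (hlim.add tendsto_const_nhds) ?_
    filter_upwards [hev R] with h hh
    exact hR h hh
  · rwa [ENNReal.coe_toNNReal htop]

end Difference

/-! ### Measurability in the increment -/

section Measurability

variable {N : ℕ} {𝕜 : Type*} [RCLike 𝕜]

theorem continuous_kthDifference_apply {g : EuclideanSpace ℝ (Fin N) → 𝕜} (hg : Continuous g)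
    (k : ℕ) (x : EuclideanSpace ℝ (Fin N)) : Continuous fun h => kthDifference k h g x := by
  unfold kthDifference
  fun_prop

theorem Continuous.kthDifference {g : EuclideanSpace ℝ (Fin N) → 𝕜} (hg : Continuous g)
    (k : ℕ) (h : EuclideanSpace ℝ (Fin N)) : Continuous (kthDifference k h g) := by
  unfold _root_.kthDifference
  fun_prop

/-- By the Fatou property the function is even lower semicontinuous. -/
theorem RISpace.measurable_enorm_kthDifference (X : RISpace N)
    {g : EuclideanSpace ℝ (Fin N) → 𝕜} (hg : Continuous g) (k : ℕ) :
    Measurable fun h => X.enorm (kthDifference k h g) := by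
  refine measurable_of_Iic fun a => (IsSeqClosed.isClosed fun hs h hsa hlim => ?_).measurableSet
  refine X.rho_le_of_tendsto (u := fun n x => ‖kthDifference k (hs n) g x‖ₑ)
    (fun n => (hg.kthDifference k (hs n)).measurable.enorm) (fun x => ?_) hsa
  exact (continuous_enorm.comp (continuous_kthDifference_apply hg k x)).continuousAt.tendsto.comp
    hlim

/-- The value `z` at the point `x`, cut off continuously: it is multiplied by a factor in `[0, 1]`
so that the result has norm at most `n + 1` and vanishes for `‖x‖ ≥ n + 1`, while `z` is unchanged
if `‖x‖ ≤ n` and `‖z‖ ≤ n + 1`. -/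
noncomputable def cutoff (n : ℕ) (x : EuclideanSpace ℝ (Fin N)) (z : 𝕜) : 𝕜 :=
  (max 0 (min 1 ((n : ℝ) + 1 - ‖x‖)) * (((n : ℝ) + 1) / max ((n : ℝ) + 1) ‖z‖)) • z

theorem continuous_cutoff (n : ℕ) :
    Continuous fun p : EuclideanSpace ℝ (Fin N) × 𝕜 => cutoff n p.1 p.2 := by
  unfold cutoff
  refine Continuous.smul (Continuous.mul (by fun_prop) (Continuous.div (by fun_prop) (by fun_prop)
    fun p => ?_)) (by fun_prop)
  exact (lt_max_of_lt_left (by positivity)).ne'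

theorem cutoff_of_le {n : ℕ} {x : EuclideanSpace ℝ (Fin N)} {z : 𝕜} (hx : ‖x‖ ≤ n)
    (hz : ‖z‖ ≤ n + 1) : cutoff n x z = z := by
  rw [cutoff, max_eq_left hz, div_self (by positivity), min_eq_left (by linarith)]
  simp

theorem cutoff_of_ge {n : ℕ} {x : EuclideanSpace ℝ (Fin N)} (z : 𝕜) (hx : (n : ℝ) + 1 ≤ ‖x‖) :
    cutoff n x z = 0 := by
  rw [cutoff, max_eq_left (min_le_of_right_le (by linarith))]
  simp

theorem norm_cutoff_le (n : ℕ) (x : EuclideanSpace ℝ (Fin N)) (z : 𝕜) :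
    ‖cutoff n x z‖ ≤ n + 1 := by
  have hpos : 0 < max ((n : ℝ) + 1) ‖z‖ := lt_max_of_lt_left (by positivity)
  have h1 : 0 ≤ max 0 (min 1 ((n : ℝ) + 1 - ‖x‖)) := le_max_left _ _
  have h2 : max 0 (min 1 ((n : ℝ) + 1 - ‖x‖)) ≤ 1 := max_le zero_le_one (min_le_left _ _)
  rw [cutoff, norm_smul, Real.norm_of_nonneg (by positivity), mul_assoc, div_mul_eq_mul_div]
  have h3 : ((n : ℝ) + 1) * ‖z‖ / max ((n : ℝ) + 1) ‖z‖ ≤ n + 1 := by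
    rw [div_le_iff₀ hpos]
    gcongr
    exact le_max_right _ _
  exact (mul_le_of_le_one_left (by positivity) h2).trans h3

theorem norm_sub_cutoff_le (n : ℕ) (x : EuclideanSpace ℝ (Fin N)) (z : 𝕜) :
    ‖z - cutoff n x z‖ ≤ ‖z‖ := by
  have hpos : 0 < max ((n : ℝ) + 1) ‖z‖ := lt_max_of_lt_left (by positivity)
  have h1 : 0 ≤ max 0 (min 1 ((n : ℝ) + 1 - ‖x‖)) := le_max_left _ _
  have h2 : max 0 (min 1 ((n : ℝ) + 1 - ‖x‖)) ≤ 1 := max_le zero_le_one (min_le_left _ _)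
  have h3 : ((n : ℝ) + 1) / max ((n : ℝ) + 1) ‖z‖ ≤ 1 := (div_le_one hpos).2 (le_max_left _ _)
  have h4 : 0 ≤ ((n : ℝ) + 1) / max ((n : ℝ) + 1) ‖z‖ := by positivity
  rw [cutoff]
  set c := max 0 (min 1 ((n : ℝ) + 1 - ‖x‖)) * (((n : ℝ) + 1) / max ((n : ℝ) + 1) ‖z‖)
  have hc0 : 0 ≤ c := mul_nonneg h1 h4
  have hc1 : c ≤ 1 := mul_le_one₀ h2 h4 h3
  rw [show z - c • z = (1 - c) • z by rw [sub_smul, one_smul], norm_smul,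
    Real.norm_of_nonneg (by linarith)]
  exact mul_le_of_le_one_left (norm_nonneg z) (by linarith)

theorem cutoff_zero (n : ℕ) (x : EuclideanSpace ℝ (Fin N)) : cutoff n x (0 : 𝕜) = 0 :=
  smul_zero _

-- The lemmas above are the complete interface of `cutoff`; unification must not unfold it.
attribute [irreducible] cutoff

theorem stronglyMeasurable_cutoff {f : EuclideanSpace ℝ (Fin N) → 𝕜} (hf : StronglyMeasurable f)
    (n : ℕ) : StronglyMeasurable fun x => cutoff n x (f x) :=
  (continuous_cutoff n).comp_stronglyMeasurable (stronglyMeasurable_id.prodMk hf)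

theorem integrable_cutoff {f : EuclideanSpace ℝ (Fin N) → 𝕜} (hf : StronglyMeasurable f) (n : ℕ) :
    Integrable (fun x => cutoff n x (f x)) volume := by
  have hsupp : (Function.support fun x => cutoff n x (f x)) ⊆ Metric.closedBall 0 (n + 1) := by
    intro x hx
    by_contra hx'
    exact hx (cutoff_of_ge _ (by simpa using (not_le.1 (by simpa using hx') : _ < _).le))
  rw [← integrableOn_iff_integrable_of_support_subset hsupp]
  exact Measure.integrableOn_of_bounded (M := n + 1) measure_closedBall_lt_top.ne
    (stronglyMeasurable_cutoff hf n).aestronglyMeasurable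
    (ae_of_all _ fun x => norm_cutoff_le n x (f x))

/-- An integrable function is the almost everywhere limit of continuous functions. -/
theorem MeasureTheory.Integrable.exists_continuous_tendsto_ae
    {f : EuclideanSpace ℝ (Fin N) → 𝕜} (hf : Integrable f volume) :
    ∃ g : ℕ → EuclideanSpace ℝ (Fin N) → 𝕜, (∀ m, Continuous (g m)) ∧
      ∀ᵐ x ∂volume, Tendsto (fun m => g m x) atTop (𝓝 (f x)) := by
  have hex : ∀ m : ℕ, ∃ g : EuclideanSpace ℝ (Fin N) → 𝕜,
      eLpNorm (f - g) 1 volume ≤ (m : ℝ≥0∞)⁻¹ ∧ Continuous g := fun m => by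
    obtain ⟨g, -, h1, h2, -⟩ := (memLp_one_iff_integrable.2 hf).exists_hasCompactSupport_eLpNorm_sub_le
      ENNReal.one_ne_top (ε := (m : ℝ≥0∞)⁻¹) (by simp)
    exact ⟨g, h1, h2⟩
  choose g hg hgc using hex
  have hlim : Tendsto (fun m => eLpNorm (g m - f) 1 volume) atTop (𝓝 0) :=
    tendsto_of_tendsto_of_tendsto_of_le_of_le tendsto_const_nhds
      ENNReal.tendsto_inv_nat_nhds_zero (fun _ => zero_le)
      fun m => by rw [eLpNorm_sub_comm]; exact hg m
  obtain ⟨ns, -, hns⟩ := (tendstoInMeasure_of_tendsto_eLpNorm one_ne_zero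
    (fun m => (hgc m).aestronglyMeasurable) hf.aestronglyMeasurable hlim).exists_seq_tendsto_ae
  exact ⟨fun m => g (ns m), fun m => hgc _, hns⟩

theorem tendsto_enorm_sub_zero {ι : Type*} {l : Filter ι} {F : ι → 𝕜} {z : 𝕜}
    (h : Tendsto F l (𝓝 z)) : Tendsto (fun i => ‖z - F i‖ₑ) l (𝓝 0) := by
  simpa [Function.comp_def] using
    (continuous_enorm.tendsto _).comp ((tendsto_const_nhds (x := z)).sub h)

/-- Continuous functions approximate every element of a space with absolutely continuous norm. -/
theorem RISpace.Mem.exists_continuous_enorm_sub_le {X : RISpace N}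
    (hX : X.HasAbsolutelyContinuousNorm) {f : EuclideanSpace ℝ (Fin N) → 𝕜} (hf : X.Mem f)
    {δ : ℝ≥0∞} (hδ : 0 < δ) :
    ∃ g : EuclideanSpace ℝ (Fin N) → 𝕜, Continuous g ∧ X.enorm (fun x => f x - g x) ≤ δ := by
  wlog hfm : StronglyMeasurable f generalizing f
  · have hfX : X.Mem (hf.1.mk f) := by
      refine ⟨hf.1.stronglyMeasurable_mk.aestronglyMeasurable, lt_of_eq_of_lt ?_ hf.2⟩
      refine X.rho_congr_ae hf.1.stronglyMeasurable_mk.enorm.aemeasurable ?_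
      filter_upwards [hf.1.ae_eq_mk] with x hx using by rw [hx]
    obtain ⟨g, hgc, hg⟩ := this hfX hf.1.stronglyMeasurable_mk
    refine ⟨g, hgc, le_of_eq_of_le ?_ hg⟩
    refine X.rho_congr_ae (hf.1.sub hgc.aestronglyMeasurable).enorm ?_
    filter_upwards [hf.1.ae_eq_mk] with x hx using by rw [hx]
  have hδ2 : 0 < δ / 2 := ENNReal.half_pos hδ.ne'
  -- First replace `f` by a bounded function of bounded support.
  obtain ⟨n, hn⟩ : ∃ n : ℕ, X.enorm (fun x => f x - cutoff n x (f x)) ≤ δ / 2 := by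
    refine (ENNReal.tendsto_nhds_zero.1 (hX.tendsto_rho_zero (F := fun x => ‖f x‖ₑ)
      (u := fun n x => ‖f x - cutoff n x (f x)‖ₑ)
      (fun n => (hfm.sub (stronglyMeasurable_cutoff hfm n)).enorm) hfm.enorm hf.2
      (fun n x => enorm_le_iff_norm_le.2 (norm_sub_cutoff_le n x (f x)))
      (ae_of_all _ fun x => tendsto_enorm_sub_zero ?_)) _ hδ2).exists
    refine tendsto_const_nhds.congr' ?_
    filter_upwards [eventually_ge_atTop ⌈‖x‖⌉₊, eventually_ge_atTop ⌈‖f x‖⌉₊] with n h1 h2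
    exact (cutoff_of_le ((Nat.le_ceil _).trans (by exact_mod_cast h1))
      ((Nat.le_ceil _).trans (by exact_mod_cast h2.trans n.le_succ))).symm
  set T : EuclideanSpace ℝ (Fin N) → 𝕜 := fun x => cutoff n x (f x)
  have hTm : StronglyMeasurable T := stronglyMeasurable_cutoff hfm n
  -- The next cutoff leaves `T` unchanged, and keeps the continuous approximants dominated.
  have hTT : ∀ x, cutoff (n + 1) x (T x) = T x := by
    intro x
    by_cases hx : (n : ℝ) + 1 ≤ ‖x‖
    · have : T x = 0 := cutoff_of_ge _ hx
      rw [this, cutoff_zero]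
    · refine cutoff_of_le (by push_cast; linarith) ?_
      push_cast
      linarith [norm_cutoff_le n x (f x)]
  obtain ⟨g, hgc, hg⟩ := (integrable_cutoff hfm n).exists_continuous_tendsto_ae
  have hcut : ∀ m, Continuous fun x => cutoff (n + 1) x (g m x) := fun m =>
    (continuous_cutoff (n + 1)).comp (continuous_id.prodMk (hgc m))
  set B : Set (EuclideanSpace ℝ (Fin N)) := Metric.closedBall 0 (n + 2)
  have hB : MeasurableSet B := Metric.isClosed_closedBall.measurableSet
  set K : ℝ≥0 := (n + 1) + (n + 2)
  have h1m : Measurable (B.indicator fun _ => (1 : ℝ≥0∞)) := measurable_const.indicator hB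
  obtain ⟨m, hm⟩ : ∃ m : ℕ, X.enorm (fun x => T x - cutoff (n + 1) x (g m x)) ≤ δ / 2 := by
    refine (ENNReal.tendsto_nhds_zero.1 (hX.tendsto_rho_zero
      (F := fun x => (K : ℝ≥0∞) * B.indicator (fun _ => 1) x)
      (u := fun m x => ‖T x - cutoff (n + 1) x (g m x)‖ₑ)
      (fun m => (hTm.sub (hcut m).stronglyMeasurable).enorm) (h1m.const_mul _) ?_
      (fun m x => ?_) ?_) _ hδ2).exists
    · rw [X.rho_const_mul _ _ h1m.aemeasurable]
      exact ENNReal.mul_lt_top ENNReal.coe_lt_top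
        (X.rho_indicator_lt_top B hB measure_closedBall_lt_top)
    · by_cases hx : x ∈ B
      · rw [Set.indicator_of_mem hx, mul_one, enorm_eq_nnnorm, ENNReal.coe_le_coe,
          ← NNReal.coe_le_coe, coe_nnnorm]
        refine (norm_sub_le _ _).trans ?_
        have h1 := norm_cutoff_le n x (f x)
        have h2 := norm_cutoff_le (n + 1) x (g m x)
        push_cast [K] at h2 ⊢
        linarith
      · have hx' : (n : ℝ) + 2 < ‖x‖ := by simpa [B] using hx
        have h1 : T x = 0 := cutoff_of_ge _ (by linarith)
        have h2 : cutoff (n + 1) x (g m x) = 0 := cutoff_of_ge _ (by push_cast; linarith)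
        simp [h1, h2]
    · filter_upwards [hg] with x hx
      refine tendsto_enorm_sub_zero ?_
      have := ((continuous_cutoff (n + 1)).tendsto (x, T x)).comp
        (tendsto_const_nhds.prodMk_nhds hx)
      simpa only [hTT, Function.comp_def] using this
  refine ⟨fun x => cutoff (n + 1) x (g m x), hcut m, ?_⟩
  rw [← ENNReal.add_halves δ]
  refine le_trans ?_ (add_le_add hn hm)
  refine le_trans (X.rho_mono _ _ (hfm.sub (hcut m).stronglyMeasurable).enorm.aemeasurable
    ((hfm.sub hTm).enorm.add (hTm.sub (hcut m).stronglyMeasurable).enorm).aemeasurable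
    (ae_of_all _ fun x => ?_)) (X.rho_add_le _ _ (hfm.sub hTm).enorm.aemeasurable
      (hTm.sub (hcut m).stronglyMeasurable).enorm.aemeasurable)
  calc ‖f x - cutoff (n + 1) x (g m x)‖ₑ
      = ‖(f x - T x) + (T x - cutoff (n + 1) x (g m x))‖ₑ := by rw [sub_add_sub_cancel]
    _ ≤ _ := enorm_add_le _ _

/-- The function is a uniform limit of those belonging to continuous functions. -/
theorem RISpace.Mem.measurable_enorm_kthDifference {X : RISpace N}
    (hX : X.HasAbsolutelyContinuousNorm) {f : EuclideanSpace ℝ (Fin N) → 𝕜} (hf : X.Mem f)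
    (k : ℕ) : Measurable fun h => X.enorm (kthDifference k h f) := by
  have hex : ∀ m : ℕ, ∃ g : EuclideanSpace ℝ (Fin N) → 𝕜, Continuous g ∧
      X.enorm (fun x => f x - g x) ≤ (m : ℝ≥0∞)⁻¹ := fun m =>
    hf.exists_continuous_enorm_sub_le hX (by simp)
  choose g hgc hg using hex
  refine measurable_of_tendsto_metrizable
    (fun m => X.measurable_enorm_kthDifference (hgc m) k) (tendsto_pi_nhds.2 fun h => ?_)
  have hfin : X.enorm (kthDifference k h f) ≠ ∞ :=
    ((X.enorm_kthDifference_le hf.1 k h).trans_lt (ENNReal.mul_lt_top (by simp) hf.2)).ne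
  have hsmall : Tendsto (fun m : ℕ => 2 ^ k * (m : ℝ≥0∞)⁻¹) atTop (𝓝 0) := by
    simpa using ENNReal.Tendsto.const_mul ENNReal.tendsto_inv_nat_nhds_zero
      (Or.inr (by simp : (2 : ℝ≥0∞) ^ k ≠ ∞))
  rw [ENNReal.tendsto_nhds hfin]
  intro η hη
  filter_upwards [ENNReal.tendsto_nhds_zero.1 hsmall η hη] with m hm
  have hgm := (hgc m).aestronglyMeasurable (μ := volume)
  have herr : 2 ^ k * X.enorm (fun x => f x - g m x) ≤ η := le_trans (by gcongr; exact hg m) hm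
  constructor
  · rw [tsub_le_iff_right]
    exact (X.enorm_kthDifference_le_add hf.1 hgm k h).trans (add_le_add_right herr _)
  · refine (X.enorm_kthDifference_le_add hgm hf.1 k h).trans (add_le_add_right ?_ _)
    rwa [X.enorm_sub_comm]

end Measurability

/-! ### The radial weights -/

section Weight

variable {N k : ℕ}

theorem IsConcentratingAtInfinity.integrableOn {ψ : ℝ → ℝ → ℝ} (hψ : IsConcentratingAtInfinity ψ)
    {ε : ℝ} (hε : 0 < ε) : IntegrableOn (ψ ε) (Set.Ioi 0) := by
  by_contra h
  have := hψ.integral_eq_one ε hε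
  rw [integral_undef h] at this
  exact zero_ne_one this

theorem IsConcentratingAtInfinity.lintegral_eq_one {ψ : ℝ → ℝ → ℝ}
    (hψ : IsConcentratingAtInfinity ψ) {ε : ℝ} (hε : 0 < ε) :
    ∫⁻ t in Set.Ioi (0 : ℝ), ENNReal.ofReal (ψ ε t) = 1 := by
  rw [← ofReal_integral_eq_lintegral_ofReal (hψ.integrableOn hε)
    ((ae_restrict_iff' measurableSet_Ioi).2 (ae_of_all _ (hψ.nonneg ε hε))),
    hψ.integral_eq_one ε hε, ENNReal.ofReal_one]

/-- The mass of `ψ ε` on bounded intervals disappears as `ε → 0+`. -/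
theorem IsConcentratingAtInfinity.tendsto_lintegral_Ioc {ψ : ℝ → ℝ → ℝ}
    (hψ : IsConcentratingAtInfinity ψ) {a : ℝ} (ha : 1 < a) :
    Tendsto (fun ε => ∫⁻ t in Set.Ioc 0 a, ENNReal.ofReal (ψ ε t)) (𝓝[>] 0) (𝓝 0) := by
  have h0a : (0 : ℝ) ≤ a := by linarith
  have h1 : Tendsto (fun ε => ENNReal.ofReal (1 - ∫ t in Set.Ioi a, ψ ε t)) (𝓝[>] 0) (𝓝 0) := by
    have := ENNReal.tendsto_ofReal ((tendsto_const_nhds (x := (1 : ℝ))).sub (hψ.tendsto_tail a ha))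
    simpa using this
  refine h1.congr' ?_
  filter_upwards [self_mem_nhdsWithin] with ε hε
  have hint := hψ.integrableOn hε
  have hsplit : ∫ t in Set.Ioi (0 : ℝ), ψ ε t =
      (∫ t in Set.Ioc 0 a, ψ ε t) + ∫ t in Set.Ioi a, ψ ε t := by
    rw [← Set.Ioc_union_Ioi_eq_Ioi h0a]
    exact setIntegral_union (Set.Ioc_disjoint_Ioi le_rfl) measurableSet_Ioi
      (hint.mono_set Set.Ioc_subset_Ioi_self) (hint.mono_set (Set.Ioi_subset_Ioi h0a))
  rw [← ofReal_integral_eq_lintegral_ofReal (hint.mono_set Set.Ioc_subset_Ioi_self)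
    ((ae_restrict_iff' measurableSet_Ioc).2 (ae_of_all _ fun t ht => hψ.nonneg ε hε t ht.1)),
    ← hψ.integral_eq_one ε hε, hsplit, add_sub_cancel_right]

/-- The lower integral representing `tailWeight N k ψ t` for `t > 0`. -/
theorem ofReal_tailWeight {ψ : ℝ → ℝ} (hψ : ∀ t > 0, 0 ≤ ψ t)
    (hint : IntegrableOn ψ (Set.Ioi 0)) {t : ℝ} (ht : 0 < t) :
    ENNReal.ofReal (tailWeight N k ψ t) =
      ∫⁻ u in Set.Ioi (0 : ℝ), (Set.Ioi (t ^ k)).indicator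
        (fun u => ENNReal.ofReal (u ^ (-((N : ℝ) / (k : ℝ))) * ψ u)) u := by
  have htk : 0 < t ^ k := pow_pos ht k
  have hsub : Set.Ioi (t ^ k) ⊆ Set.Ioi (0 : ℝ) := Set.Ioi_subset_Ioi htk.le
  rw [lintegral_indicator measurableSet_Ioi, Measure.restrict_restrict measurableSet_Ioi,
    Set.inter_eq_left.2 hsub, tailWeight, ofReal_integral_eq_lintegral_ofReal]
  · -- The factor `u ^ (-N / k)` is bounded away from the origin.
    refine Integrable.bdd_mul (c := (t ^ k) ^ (-((N : ℝ) / (k : ℝ)))) (hint.mono_set hsub) ?_ ?_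
    · exact ((measurable_id.pow_const _)).aestronglyMeasurable
    · refine (ae_restrict_iff' measurableSet_Ioi).2 (ae_of_all _ fun u hu => ?_)
      rw [Real.norm_eq_abs, abs_of_nonneg (Real.rpow_nonneg (hsub hu).le _)]
      exact Real.rpow_le_rpow_of_nonpos htk (le_of_lt hu) (neg_nonpos.2 (by positivity))
  · refine (ae_restrict_iff' measurableSet_Ioi).2 (ae_of_all _ fun u hu => ?_)
    exact mul_nonneg (Real.rpow_nonneg (hsub hu).le _) (hψ u (hsub hu))

/-- The layer-cake kernel of the weight, jointly in `h` and `u`. -/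
theorem aemeasurable_uncurry_tailKernel {ψ : ℝ → ℝ} (hint : IntegrableOn ψ (Set.Ioi 0)) :
    AEMeasurable (Function.uncurry fun (h : EuclideanSpace ℝ (Fin N)) (u : ℝ) =>
      (Set.Ioi (‖h‖ ^ k)).indicator
        (fun u => ENNReal.ofReal (u ^ (-((N : ℝ) / (k : ℝ))) * ψ u)) u)
      ((volume : Measure (EuclideanSpace ℝ (Fin N))).prod (volume.restrict (Set.Ioi 0))) := by
  have h1 : AEMeasurable (fun u : ℝ => ENNReal.ofReal (u ^ (-((N : ℝ) / (k : ℝ))) * ψ u))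
      (volume.restrict (Set.Ioi 0)) :=
    ((measurable_id.pow_const _).aemeasurable.mul hint.aestronglyMeasurable.aemeasurable).ennreal_ofReal
  have hS : MeasurableSet {p : EuclideanSpace ℝ (Fin N) × ℝ | ‖p.1‖ ^ k < p.2} :=
    measurableSet_lt (by fun_prop) (by fun_prop)
  exact (h1.comp_snd).indicator hS

theorem ae_ofReal_tailWeight_norm {ψ : ℝ → ℝ} (hN : 1 ≤ N) (hψ : ∀ t > 0, 0 ≤ ψ t)
    (hint : IntegrableOn ψ (Set.Ioi 0)) :
    (fun h : EuclideanSpace ℝ (Fin N) => ENNReal.ofReal (tailWeight N k ψ ‖h‖)) =ᵐ[volume]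
      fun h => ∫⁻ u in Set.Ioi (0 : ℝ), (Set.Ioi (‖h‖ ^ k)).indicator
        (fun u => ENNReal.ofReal (u ^ (-((N : ℝ) / (k : ℝ))) * ψ u)) u := by
  have : Nonempty (Fin N) := ⟨⟨0, hN⟩⟩
  filter_upwards [Measure.ae_ne volume (0 : EuclideanSpace ℝ (Fin N))] with h hh
  exact ofReal_tailWeight hψ hint (norm_pos_iff.2 hh)

theorem aemeasurable_tailWeight_norm {ψ : ℝ → ℝ} (hN : 1 ≤ N) (hψ : ∀ t > 0, 0 ≤ ψ t)
    (hint : IntegrableOn ψ (Set.Ioi 0)) :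
    AEMeasurable (fun h : EuclideanSpace ℝ (Fin N) => ENNReal.ofReal (tailWeight N k ψ ‖h‖))
      volume :=
  (aemeasurable_uncurry_tailKernel hint).lintegral_prod_right'.congr
    (ae_ofReal_tailWeight_norm hN hψ hint).symm

/-- Tonelli's theorem for the weight. -/
theorem setLIntegral_tailWeight_norm {ψ : ℝ → ℝ} (hN : 1 ≤ N) (hψ : ∀ t > 0, 0 ≤ ψ t)
    (hint : IntegrableOn ψ (Set.Ioi 0))
    (S : Set (EuclideanSpace ℝ (Fin N))) :
    ∫⁻ h in S, ENNReal.ofReal (tailWeight N k ψ ‖h‖) =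
      ∫⁻ u in Set.Ioi (0 : ℝ), ENNReal.ofReal (u ^ (-((N : ℝ) / (k : ℝ))) * ψ u) *
        volume ({h : EuclideanSpace ℝ (Fin N) | ‖h‖ ^ k < u} ∩ S) := by
  rw [lintegral_congr_ae (ae_restrict_of_ae (ae_ofReal_tailWeight_norm hN hψ hint)),
    lintegral_lintegral_swap]
  · refine lintegral_congr fun u => ?_
    have hm : MeasurableSet {h : EuclideanSpace ℝ (Fin N) | ‖h‖ ^ k < u} :=
      measurableSet_lt (by fun_prop) (by fun_prop)
    rw [← Measure.restrict_apply hm, ← lintegral_indicator_const hm]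
    rfl
  · refine (aemeasurable_uncurry_tailKernel hint).mono_ac ?_
    exact Measure.restrict_le_self.absolutelyContinuous.prod Measure.AbsolutelyContinuous.rfl

theorem volume_norm_pow_lt (hk : 1 ≤ k) (hN : 1 ≤ N) {u : ℝ} (hu : 0 < u) :
    volume {h : EuclideanSpace ℝ (Fin N) | ‖h‖ ^ k < u} =
      ENNReal.ofReal (u ^ ((N : ℝ) / (k : ℝ))) *
        volume (Metric.ball (0 : EuclideanSpace ℝ (Fin N)) 1) := by
  have : Nonempty (Fin N) := ⟨⟨0, hN⟩⟩
  have hk0 : (k : ℝ) ≠ 0 := by positivity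
  have hset : {h : EuclideanSpace ℝ (Fin N) | ‖h‖ ^ k < u} =
      Metric.ball 0 (u ^ ((k : ℝ)⁻¹)) := by
    ext h
    rw [mem_ball_zero_iff, Set.mem_ofPred_eq, Real.lt_rpow_inv_iff_of_pos (norm_nonneg _) hu.le
      (by positivity), Real.rpow_natCast]
  rw [hset, Measure.addHaar_ball _ _ (by positivity), finrank_euclideanSpace_fin,
    ← Real.rpow_natCast, ← Real.rpow_mul hu.le, inv_mul_eq_div]

theorem ofReal_mul_volume_norm_pow_lt (hk : 1 ≤ k) (hN : 1 ≤ N) {ψ : ℝ → ℝ} {u : ℝ} (hu : 0 < u) :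
    ENNReal.ofReal (u ^ (-((N : ℝ) / (k : ℝ))) * ψ u) *
        volume {h : EuclideanSpace ℝ (Fin N) | ‖h‖ ^ k < u} =
      ENNReal.ofReal (ψ u) * volume (Metric.ball (0 : EuclideanSpace ℝ (Fin N)) 1) := by
  rw [volume_norm_pow_lt hk hN hu, ← mul_assoc, mul_comm (ENNReal.ofReal _) (ENNReal.ofReal _),
    ← ENNReal.ofReal_mul (by positivity), ← mul_assoc, ← Real.rpow_add hu, add_neg_cancel,
    Real.rpow_zero, one_mul]

/-- The weights have constant total mass, the volume of the unit ball. -/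
theorem IsConcentratingAtInfinity.lintegral_tailWeight {ψ : ℝ → ℝ → ℝ}
    (hψ : IsConcentratingAtInfinity ψ) (hk : 1 ≤ k) (hN : 1 ≤ N) {ε : ℝ} (hε : 0 < ε) :
    ∫⁻ h : EuclideanSpace ℝ (Fin N), ENNReal.ofReal (tailWeight N k (ψ ε) ‖h‖) =
      volume (Metric.ball (0 : EuclideanSpace ℝ (Fin N)) 1) := by
  have h := setLIntegral_tailWeight_norm (k := k) hN (hψ.nonneg ε hε) (hψ.integrableOn hε) Set.univ
  simp only [Set.inter_univ, Measure.restrict_univ] at h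
  rw [h, setLIntegral_congr_fun measurableSet_Ioi
      (fun u hu => ofReal_mul_volume_norm_pow_lt hk hN hu),
    lintegral_mul_const' _ _ measure_ball_lt_top.ne, hψ.lintegral_eq_one hε, one_mul]

/-- The mass of the weights escapes to infinity: it vanishes in the limit on every ball. -/
theorem IsConcentratingAtInfinity.tendsto_setLIntegral_tailWeight {ψ : ℝ → ℝ → ℝ}
    (hψ : IsConcentratingAtInfinity ψ) (hk : 1 ≤ k) (hN : 1 ≤ N) (R : ℝ) :
    Tendsto (fun ε => ∫⁻ h in Metric.closedBall (0 : EuclideanSpace ℝ (Fin N)) R,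
      ENNReal.ofReal (tailWeight N k (ψ ε) ‖h‖)) (𝓝[>] 0) (𝓝 0) := by
  set ω := volume (Metric.ball (0 : EuclideanSpace ℝ (Fin N)) 1)
  have hω : ω ≠ ∞ := measure_ball_lt_top.ne
  set V := volume (Metric.closedBall (0 : EuclideanSpace ℝ (Fin N)) R)
  have hV : V ≠ ∞ := measure_closedBall_lt_top.ne
  have hq : 0 < (N : ℝ) / k := by positivity
  -- Split the outer integral at `a`; beyond `a` the factor `u ^ (-N / k)` is at most `a ^ (-N / k)`.
  have hbound : ∀ a : ℝ, 1 < a → ∀ ε : ℝ, 0 < ε →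
      ∫⁻ h in Metric.closedBall (0 : EuclideanSpace ℝ (Fin N)) R,
        ENNReal.ofReal (tailWeight N k (ψ ε) ‖h‖) ≤
      (∫⁻ t in Set.Ioc 0 a, ENNReal.ofReal (ψ ε t)) * ω +
        ENNReal.ofReal (a ^ (-((N : ℝ) / k))) * V := by
    intro a ha ε hε
    have h0a : (0 : ℝ) < a := by linarith
    rw [setLIntegral_tailWeight_norm hN (hψ.nonneg ε hε) (hψ.integrableOn hε),
      ← Set.Ioc_union_Ioi_eq_Ioi h0a.le]
    refine (lintegral_union_le _ _ _).trans (add_le_add ?_ ?_)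
    · rw [← lintegral_mul_const' _ _ hω]
      refine setLIntegral_mono' measurableSet_Ioc fun u hu => ?_
      rw [← ofReal_mul_volume_norm_pow_lt hk hN hu.1]
      gcongr
      exact Set.inter_subset_left
    · calc _ ≤ ∫⁻ u in Set.Ioi a, ENNReal.ofReal (ψ ε u) *
            (ENNReal.ofReal (a ^ (-((N : ℝ) / k))) * V) := by
            refine setLIntegral_mono' measurableSet_Ioi fun u hu => ?_
            have hu0 : 0 < u := h0a.trans hu
            rw [mul_comm (u ^ _), ENNReal.ofReal_mul (hψ.nonneg ε hε u hu0), mul_assoc]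
            gcongr ENNReal.ofReal (ψ ε u) * (ENNReal.ofReal ?_ * ?_)
            · exact Real.rpow_le_rpow_of_nonpos h0a (le_of_lt hu) (by linarith)
            · exact measure_mono Set.inter_subset_right
        _ = (∫⁻ u in Set.Ioi a, ENNReal.ofReal (ψ ε u)) *
            (ENNReal.ofReal (a ^ (-((N : ℝ) / k))) * V) :=
          lintegral_mul_const' _ _ (ENNReal.mul_ne_top ENNReal.ofReal_ne_top hV)
        _ ≤ 1 * (ENNReal.ofReal (a ^ (-((N : ℝ) / k))) * V) := by
          gcongr
          rw [← hψ.lintegral_eq_one hε]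
          exact lintegral_mono_set (Set.Ioi_subset_Ioi h0a.le)
        _ = _ := one_mul _
  rw [ENNReal.tendsto_nhds_zero]
  intro η hη
  have hη2 : 0 < η / 2 := ENNReal.half_pos hη.ne'
  have hfar : Tendsto (fun a : ℝ => ENNReal.ofReal (a ^ (-((N : ℝ) / k))) * V) atTop (𝓝 0) := by
    have := ENNReal.Tendsto.mul_const (ENNReal.tendsto_ofReal (tendsto_rpow_neg_atTop hq))
      (Or.inr hV)
    simpa using this
  obtain ⟨a, haV, ha⟩ := ((ENNReal.tendsto_nhds_zero.1 hfar _ hη2).and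
    (eventually_gt_atTop 1)).exists
  have hnear : Tendsto (fun ε => (∫⁻ t in Set.Ioc 0 a, ENNReal.ofReal (ψ ε t)) * ω)
      (𝓝[>] 0) (𝓝 0) := by
    simpa using ENNReal.Tendsto.mul_const (hψ.tendsto_lintegral_Ioc ha) (Or.inr hω)
  filter_upwards [ENNReal.tendsto_nhds_zero.1 hnear _ hη2, self_mem_nhdsWithin] with ε h1 hε
  exact (hbound a ha ε hε).trans ((add_le_add h1 haV).trans_eq (ENNReal.add_halves η))

/-- Averages of a bounded function against weights of constant mass `m` which escape to infinity
converge to `m` times its limit at infinity. -/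
theorem tendsto_lintegral_mul_of_tendsto_cobounded {E ι : Type*} [NormedAddCommGroup E]
    [MeasurableSpace E] [OpensMeasurableSpace E] {μ : Measure E} {l : Filter ι}
    {w : ι → E → ℝ≥0∞} {m : ℝ≥0∞} (hm : m ≠ ∞) (hw : ∀ᶠ i in l, AEMeasurable (w i) μ)
    (hmass : ∀ᶠ i in l, ∫⁻ x, w i x ∂μ = m)
    (hball : ∀ R : ℝ, Tendsto (fun i => ∫⁻ x in Metric.closedBall 0 R, w i x ∂μ) l (𝓝 0))
    {Φ : E → ℝ≥0∞} {M b : ℝ≥0∞} (hM : M ≠ ∞) (hb : b ≠ ∞) (hΦ : ∀ x, Φ x ≤ M)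
    (hlim : Tendsto Φ (Bornology.cobounded E) (𝓝 b)) :
    Tendsto (fun i => ∫⁻ x, Φ x * w i x ∂μ) l (𝓝 (m * b)) := by
  rw [ENNReal.tendsto_nhds (ENNReal.mul_ne_top hm hb)]
  intro η hη
  have hη2 : 0 < η / 2 := ENNReal.half_pos hη.ne'
  obtain ⟨δ, hδ, hδη⟩ : ∃ δ : ℝ≥0, 0 < δ ∧ (δ : ℝ≥0∞) * m < η / 2 :=
    ENNReal.exists_nnreal_pos_mul_lt hm hη2.ne'
  obtain ⟨R, hR⟩ : ∃ R : ℝ, ∀ x : E, R < ‖x‖ → Φ x ∈ Set.Icc (b - δ) (b + δ) := by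
    have := (ENNReal.tendsto_nhds hb).1 hlim δ (by simpa using hδ)
    rw [← comap_norm_atTop, eventually_comap] at this
    obtain ⟨R, hR⟩ := (this.and (eventually_gt_atTop 0)).exists_forall_of_atTop
    exact ⟨R, fun x hx => (hR ‖x‖ hx.le).1 x rfl⟩
  set B : Set E := Metric.closedBall 0 R
  have hB : MeasurableSet B := Metric.isClosed_closedBall.measurableSet
  -- Off `B` the two functions differ by at most `δ`, on `B` each is at most `M + b`.
  have hcmp : ∀ F G : E → ℝ≥0∞, (∀ x, F x ≤ M + b) → (∀ x, R < ‖x‖ → F x ≤ G x + δ) →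
      ∀ i, AEMeasurable (w i) μ → ∫⁻ x, F x * w i x ∂μ ≤
        ∫⁻ x, G x * w i x ∂μ + (δ * ∫⁻ x, w i x ∂μ + (M + b) * ∫⁻ x in B, w i x ∂μ) := by
    intro F G hF hFG i hi
    have hMb : M + b ≠ ∞ := ENNReal.add_ne_top.2 ⟨hM, hb⟩
    rw [← lintegral_const_mul' _ _ ENNReal.coe_ne_top, ← lintegral_const_mul' _ _ hMb,
      ← lintegral_indicator hB, ← lintegral_add_right' _ ((hi.const_mul _).indicator hB),
      ← lintegral_add_right' (fun x => G x * w i x)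
        ((hi.const_mul (δ : ℝ≥0∞)).fun_add ((hi.const_mul (M + b)).indicator hB))]
    refine lintegral_mono fun x => ?_
    by_cases hx : x ∈ B
    · simp only [Set.indicator_of_mem hx]
      exact (mul_le_mul_left (hF x) _).trans (le_add_self.trans le_add_self)
    · simp only [Set.indicator_of_notMem hx, add_zero]
      rw [← add_mul]
      exact mul_le_mul_left (hFG x (by simpa [B] using hx)) _
  have hMball : Tendsto (fun i => (M + b) * ∫⁻ x in B, w i x ∂μ) l (𝓝 0) := by
    simpa using ENNReal.Tendsto.const_mul (hball R)
      (Or.inr (ENNReal.add_ne_top.2 ⟨hM, hb⟩))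
  filter_upwards [hw, hmass, ENNReal.tendsto_nhds_zero.1 hMball _ hη2] with i hi hmi hBi
  have herr : δ * ∫⁻ x, w i x ∂μ + (M + b) * ∫⁻ x in B, w i x ∂μ ≤ η := by
    rw [hmi]
    exact (add_le_add hδη.le hBi).trans_eq (ENNReal.add_halves η)
  have hconst : ∫⁻ x, b * w i x ∂μ = m * b := by
    rw [lintegral_const_mul' _ _ hb, hmi, mul_comm]
  constructor
  · rw [tsub_le_iff_right, ← hconst]
    refine (hcmp (fun _ => b) Φ (fun _ => le_add_self) (fun x hx => ?_) i hi).trans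
      (add_le_add_right herr _)
    exact tsub_le_iff_right.1 (hR x hx).1
  · rw [← hconst]
    exact (hcmp Φ (fun _ => b) (fun x => (hΦ x).trans le_self_add)
      (fun x hx => (hR x hx).2) i hi).trans (add_le_add_right herr _)

end Weight

/-! ### Conclusion -/

theorem mainTheorem7 {𝕜 : Type*} [RCLike 𝕜] (k : ℕ) (hk : 1 ≤ k) :
    ∃ c C : ℝ≥0, 0 < c ∧ 0 < C ∧
      ∀ N : ℕ, 1 ≤ N → ∀ X : RISpace N, X.HasAbsolutelyContinuousNorm →
      ∀ f : EuclideanSpace ℝ (Fin N) → 𝕜, X.Mem f →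
        AEMeasurable (fun h : EuclideanSpace ℝ (Fin N) => X.enorm (kthDifference k h f)) volume ∧
        ∃ L : ℝ≥0,
          Tendsto (fun h : EuclideanSpace ℝ (Fin N) => X.enorm (kthDifference k h f))
            (Bornology.cobounded (EuclideanSpace ℝ (Fin N))) (𝓝 (L : ℝ≥0∞)) ∧
          (c : ℝ≥0∞) * X.enorm f ≤ (L : ℝ≥0∞) ∧ (L : ℝ≥0∞) ≤ (C : ℝ≥0∞) * X.enorm f ∧
          ∀ p : ℝ, 0 < p → ∀ ψ : ℝ → ℝ → ℝ, IsConcentratingAtInfinity ψ →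
            Tendsto
              (fun ε : ℝ => ∫⁻ h : EuclideanSpace ℝ (Fin N),
                X.enorm (kthDifference k h f) ^ p * ENNReal.ofReal (tailWeight N k (ψ ε) ‖h‖))
              (𝓝[>] 0)
              (𝓝 ((volume : Measure (EuclideanSpace ℝ (Fin N))).toSphere Set.univ / (N : ℝ≥0∞)
                * (L : ℝ≥0∞) ^ p)) := by
  refine ⟨1, 2 ^ k, one_pos, by positivity, fun N hN X hX f hf =>
    ⟨(hf.measurable_enorm_kthDifference hX k).aemeasurable, ?_⟩⟩
  obtain ⟨L, hL, hlow, hup⟩ := hf.exists_tendsto_enorm_kthDifference hN hX k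
  refine ⟨L, hL, by simpa using hlow, by simpa using hup, fun p hp ψ hψ => ?_⟩
  have hsphere : (volume : Measure (EuclideanSpace ℝ (Fin N))).toSphere Set.univ / (N : ℝ≥0∞) =
      volume (Metric.ball (0 : EuclideanSpace ℝ (Fin N)) 1) := by
    rw [Measure.toSphere_apply_univ, finrank_euclideanSpace_fin, mul_comm,
      ENNReal.mul_div_cancel_right (by simp; omega) (by simp)]
  rw [hsphere]
  refine tendsto_lintegral_mul_of_tendsto_cobounded (M := (2 ^ k * X.enorm f) ^ p)
    measure_ball_lt_top.ne ?_ ?_ (hψ.tendsto_setLIntegral_tailWeight hk hN) ?_ ?_ (fun h => ?_) ?_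
  · filter_upwards [self_mem_nhdsWithin] with ε hε
    exact aemeasurable_tailWeight_norm hN (hψ.nonneg ε hε) (hψ.integrableOn hε)
  · filter_upwards [self_mem_nhdsWithin] with ε hε
    exact hψ.lintegral_tailWeight hk hN hε
  · exact ENNReal.rpow_ne_top_of_nonneg hp.le (ENNReal.mul_ne_top (by simp) hf.2.ne)
  · exact ENNReal.rpow_ne_top_of_nonneg hp.le ENNReal.coe_ne_top
  · exact ENNReal.rpow_le_rpow (X.enorm_kthDifference_le hf.1 k h) hp.le
  · exact hL.ennrpow_const p
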